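/- There are absolute constants $c_1,c_2\ge 0$ such that the following holds. Let $(X_t,Y_t)_{t\ge 0}$ be a stochastic process, where the features $X_t$ take values in a measurable space and $Y_t=(Y_t^{(1)},\dots,Y_t^{(N)})\in\mathbb R^N$ collects the responses at $N$ nodes. Assume that it is $\beta$-mixing with $\beta(\tau)\le C\rho^{\tau}$ for all integers $\tau\ge 1$, where $C>0$, $\rho\in(0,1)$, and $$\beta(\tau)=\sup_{t}\ \sup\ \tfrac12\sum_{i,j}\bigl|\mathbb P(A_i\cap B_j)-\mathbb P(A_i)\mathbb P(B_j)\bigr| ,$$ the inner supremum being over all finite partitions $(A_i)$, $(B_j)$ of the sample space into events of $\sigma((X_s,Y_s):s\le t)$ and of $\sigma((X_s,Y_s):s\ge t+\tau)$, respectively. (Stationarity is not assumed.) Let $\hat\mu_t^{(i)}\in\mathbb R$ and $\hat\sigma_t^{(i)}>0$ be forecasts for node $i$ at time $t$ that are measurable functions of $(X_s)_{s\le t}$ and $(Y_s)_{s<t}$, and let $R_t^{(i)}=|Y_t^{(i)}-\hat\mu_t^{(i)}|/\hat\sigma_t^{(i)}$ be the conformity scores. Let the nodes be partitioned into clusters $\mathcal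 C_1,\dots,\mathcal C_K$, let $\mathcal T_{\rm cal}$ be a finite set of calibration times, and let $t_0$ be the first test time, such that every $s\in\mathcal T_{\rm cal}$ satisfies $s<t_0$ and $s+\tau_{\rm gap}\le t_0$. Assume that the calibration set $\{(s,i):s\in\mathcal T_{\rm cal},\,i\in\mathcal C_k\}$ of each cluster has size $n_k\ge n_{\min}\ge 1$. For $a\in\mathbb R$ let $$q_k(a)=\inf\bigl\{x\in[-\infty,\infty]:\ \#\{(s,i)\in\mathcal T_{\rm cal}\times\mathcal C_k: R_s^{(i)}\le x\}\ \ge\ n_k\,(1-a)(1+1/n_k)\bigr\}$$ be the empirical quantile of level $(1-a)(1+1/n_k)$ of the calibration scores of cluster $k$ (with $\inf\emptyset=+\infty$, so that it is $+\infty$ for levels greater than $1$). Let $\alpha\in(0,1)$, $\gamma_{\rm ACI}\in(0,1)$ and, for each $k$, $\alpha_{t_0}^{(k)}\in[0,1]$. For $t\ge t_0$ and $i\in\mathcal C_k$ let $$\mathcal I_t^{(i)}=\bigl\{v\in\mathbb R:\ |v-\hat\mu_t^{(i)}|/\hat\sigma_t^{(i)}\le q_k(\alpha_t^{(k)})\bigr\},$$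 let $\mathcal I_t^{(\mathcal C_k)}$ be the set of all $v\in\mathbb R^N$ with $v_i\in\mathcal I_t^{(i)}$ for all $i\in\mathcal C_k$, and let the levels be updated by $$\alpha_{t+1}^{(k)}=\alpha_t^{(k)}+\gamma_{\rm ACI}\bigl(\alpha-\mathrm{err}_t^{(k)}\bigr),\qquad \mathrm{err}_t^{(k)}=\mathbf 1\bigl[Y_t\notin\mathcal I_t^{(\mathcal C_k)}\bigr].$$ Then, almost surely, for every cluster $k$, $$\limsup_{T\to\infty}\frac1T\sum_{t=t_0}^{t_0+T-1}\mathbf 1\bigl[Y_t\notin\mathcal I_t^{(\mathcal C_k)}\bigr]\ \le\ \alpha+c_1\,\frac{C\rho^{\tau_{\rm gap}}}{1-\rho}+c_2\,\gamma_{\rm ACI},$$ and, for every node $i$, $$\limsup_{T\to\infty}\frac1T\sum_{t=t_0}^{t_0+T-1}\mathbf 1\bigl[Y_t^{(i)}\notin\mathcal I_t^{(i)}\bigr]\ \le\ \alpha+c_1\,\frac{C\rho^{\tau_{\rm gap}}}{1-\rho}+c_2\,\gamma_{\rm ACI}.$$ -/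

import Mathlib

open MeasureTheory Filter
open scoped ENNReal

noncomputable section

namespace CoverageMixing

/-! ### Absolute regularity (`β`-mixing) -/

/-- The `β`-dependence coefficient of two sub-`σ`-algebras:
`β(𝒜, ℬ) = sup ½ ∑ᵢ ∑ⱼ |P(Aᵢ ∩ Bⱼ) - P(Aᵢ) P(Bⱼ)|`, the supremum being over all finite partitions
`(Aᵢ)` of `Ω` into `𝒜`-measurable sets and `(Bⱼ)` of `Ω` into `ℬ`-measurable sets. -/
def betaDep {Ω : Type*} [MeasurableSpace Ω] (P : Measure Ω) (𝒜 ℬ : MeasurableSpace Ω) : ℝ≥0∞ :=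
  ⨆ (m : ℕ) (n : ℕ) (A : Fin m → Set Ω) (B : Fin n → Set Ω)
    (_ : (∀ i, MeasurableSet[𝒜] (A i)) ∧ Pairwise (Function.onFun Disjoint A) ∧
      (⋃ i, A i) = Set.univ)
    (_ : (∀ j, MeasurableSet[ℬ] (B j)) ∧ Pairwise (Function.onFun Disjoint B) ∧
      (⋃ j, B j) = Set.univ),
    ENNReal.ofReal ((1 / 2) * ∑ i, ∑ j, |P.real (A i ∩ B j) - P.real (A i) * P.real (B j)|)

/-- The `β`-mixing coefficient `β(τ) = sup_t β(σ(Z_s : s ≤ t), σ(Z_s : s ≥ t + τ))` of a process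
(no stationarity required). -/
def betaMixing {Ω E : Type*} [MeasurableSpace Ω] [mE : MeasurableSpace E] (P : Measure Ω)
    (Z : ℕ → Ω → E) (τ : ℕ) : ℝ≥0∞ :=
  ⨆ t : ℕ, betaDep P (⨆ s ∈ Set.Iic t, mE.comap (Z s)) (⨆ s ∈ Set.Ici (t + τ), mE.comap (Z s))

/-- The information available when `Y_t` is forecast: the features up to time `t` and the
responses strictly before time `t`. -/
abbrev forecastInfo {Ω E F : Type*} [mE : MeasurableSpace E] [mF : MeasurableSpace F]
    (X : ℕ → Ω → E) (Y : ℕ → Ω → F) (t : ℕ) : MeasurableSpace Ω :=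
  (⨆ s ∈ Set.Iic t, mE.comap (X s)) ⊔ (⨆ s ∈ Set.Iio t, mF.comap (Y s))

/-! ### Split conformal calibration -/

/-- The conformity score `|y - μ̂| / σ̂`. -/
def score (y m s : ℝ) : ℝ := |y - m| / s

/-- The empirical quantile of level `p` of the finite family `(R i)_{i ∈ S}`, i.e. the least `x` such
that at least a proportion `p` of the values is `≤ x`. It is `+∞` if `p > 1` (and `S` is non-empty)
and `-∞` if `p ≤ 0`. -/
def empQuantile {ι : Type*} (p : ℝ) (S : Finset ι) (R : ι → ℝ) : EReal :=
  sInf {x : EReal | p * (S.card : ℝ) ≤ ({i ∈ (S : Set ι) | (R i : EReal) ≤ x}.ncard : ℝ)}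

/-- The nodes of cluster `k`, for the partition of the `N` nodes given by `c`. -/
def cluster {N K : ℕ} (c : Fin N → Fin K) (k : Fin K) : Finset (Fin N) :=
  Finset.univ.filter fun i => c i = k

/-- The calibration set of cluster `k`: all pairs `(t, i)` with `t` in the calibration window and
`i` in cluster `k`. -/
def calSet {N K : ℕ} (c : Fin N → Fin K) (Tcal : Finset ℕ) (k : Fin K) : Finset (ℕ × Fin N) :=
  Tcal ×ˢ cluster c k

section Procedure

/-! The procedure along one realized path: `y`, `m`, `s` are the responses, the point forecasts
`μ̂` and the scale forecasts `σ̂`, at each time and node. -/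

variable {N K : ℕ} (c : Fin N → Fin K) (Tcal : Finset ℕ) (t₀ : ℕ) (y m s : ℕ → Fin N → ℝ)

/-- The calibrated cutoff of cluster `k` at miscoverage level `a`: the quantile of level
`(1 - a) (1 + 1 / n_k)` of the calibration scores of the cluster. -/
def cutoff (k : Fin K) (a : ℝ) : EReal :=
  empQuantile ((1 - a) * (1 + 1 / ((calSet c Tcal k).card : ℝ))) (calSet c Tcal k)
    fun p => score (y p.1 p.2) (m p.1 p.2) (s p.1 p.2)

/-- The prediction interval `[μ̂ - q σ̂, μ̂ + q σ̂]` of node `i` at time `t`, with the cutoff `q` of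
the cluster of `i` at miscoverage level `a`; all of `ℝ` if `q = +∞`, empty if `q < 0`. -/
def nodeInterval (t : ℕ) (i : Fin N) (a : ℝ) : Set ℝ :=
  {v : ℝ | (score v (m t i) (s t i) : EReal) ≤ cutoff c Tcal y m s (c i) a}

/-- The prediction region of cluster `k` at time `t`: the response vectors all of whose coordinates
in cluster `k` lie in their prediction intervals. -/
def clusterRegion (t : ℕ) (k : Fin K) (a : ℝ) : Set (Fin N → ℝ) :=
  {v | ∀ i ∈ cluster c k, v i ∈ nodeInterval c Tcal y m s t i a}

/-- The miscoverage indicator `1[Y_t ∉ I_t]` of the region of cluster `k` at time `t`. -/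
def clusterErr (t : ℕ) (k : Fin K) (a : ℝ) : ℝ :=
  (clusterRegion c Tcal y m s t k a)ᶜ.indicator (fun _ => (1 : ℝ)) (y t)

/-- The miscoverage indicator of the prediction interval of node `i` at time `t`. -/
def nodeErr (t : ℕ) (i : Fin N) (a : ℝ) : ℝ :=
  (nodeInterval c Tcal y m s t i a)ᶜ.indicator (fun _ => (1 : ℝ)) (y t i)

/-- The adaptive miscoverage level of cluster `k` at the test time `t₀ + n`, `n = 0, 1, 2, …`
(`t₀` is the first test time, `a₁ k` the initial level):
`α_{t+1} = α_t + γ (α - err_t)`. -/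
def aciLevel (α γ : ℝ) (a₁ : Fin K → ℝ) (k : Fin K) : ℕ → ℝ
  | 0 => a₁ k
  | n + 1 => aciLevel α γ a₁ k n +
      γ * (α - clusterErr c Tcal y m s (t₀ + n) k (aciLevel α γ a₁ k n))

/-- Average miscoverage of the regions of cluster `k` over the first `T` test times. -/
def avgClusterErr (α γ : ℝ) (a₁ : Fin K → ℝ) (k : Fin K) (T : ℕ) : ℝ :=
  (1 / (T : ℝ)) * ∑ n ∈ Finset.range T,
    clusterErr c Tcal y m s (t₀ + n) k (aciLevel c Tcal t₀ y m s α γ a₁ k n)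

/-- Average miscoverage of the intervals of node `i` over the first `T` test times. -/
def avgNodeErr (α γ : ℝ) (a₁ : Fin K → ℝ) (i : Fin N) (T : ℕ) : ℝ :=
  (1 / (T : ℝ)) * ∑ n ∈ Finset.range T,
    nodeErr c Tcal y m s (t₀ + n) i (aciLevel c Tcal t₀ y m s α γ a₁ (c i) n)

end Procedure

end CoverageMixing

end

namespace CoverageMixing

/-! The bound is deterministic, the adaptive conformal argument along each path. Summing the update
rule expresses the number of errors up to `T` as `αT + (a₁ - α_T)/γ`, with `α_T` the level after `T`
updates (`mul_sum_clusterErr`), so only a lower bound on the level is needed. A negative level makes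
the cutoff infinite, hence no error occurs and the level rises again; it therefore never drops below
`-γ` (`neg_le_aciLevel`). The average error exceeds `α` by at most `O(1/T)`, and node errors are
dominated by cluster errors. -/

/-- The empirical quantile of a level greater than one is infinite. -/
theorem empQuantile_eq_top {ι : Type*} {p : ℝ} {S : Finset ι} (R : ι → ℝ) (hS : S.Nonempty)
    (hp : 1 < p) : empQuantile p S R = ⊤ := by
  -- Nonemptiness is essential: for empty `S` every `x` satisfies the defining inequality and the
  -- infimum is `⊥`.
  have hcard : (0 : ℝ) < S.card := by exact_mod_cast hS.card_pos
  rw [empQuantile, sInf_eq_top]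
  intro x hx
  have hle : ({i ∈ (S : Set ι) | (R i : EReal) ≤ x}.ncard : ℝ) ≤ S.card := by
    have h := Set.ncard_le_ncard (Set.sep_subset (S : Set ι) fun i => (R i : EReal) ≤ x)
      S.finite_toSet
    rw [Set.ncard_coe_finset] at h
    exact_mod_cast h
  have hx' : p * (S.card : ℝ) ≤ ({i ∈ (S : Set ι) | (R i : EReal) ≤ x}.ncard : ℝ) := hx
  -- `hx'` and `hle` contradict `1 < p`, so the set under the infimum is empty.
  nlinarith

variable {N K : ℕ} {c : Fin N → Fin K} {Tcal : Finset ℕ} {t₀ : ℕ} {y m s : ℕ → Fin N → ℝ}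

theorem cutoff_eq_top {k : Fin K} {a : ℝ} (hk : (calSet c Tcal k).Nonempty) (ha : a < 0) :
    cutoff c Tcal y m s k a = ⊤ := by
  refine empQuantile_eq_top _ hk ?_
  have h : (0 : ℝ) ≤ 1 / ((calSet c Tcal k).card : ℝ) := by positivity
  nlinarith

theorem clusterErr_nonneg (t : ℕ) (k : Fin K) (a : ℝ) : 0 ≤ clusterErr c Tcal y m s t k a :=
  Set.indicator_nonneg (fun _ _ => zero_le_one) _

theorem clusterErr_le_one (t : ℕ) (k : Fin K) (a : ℝ) : clusterErr c Tcal y m s t k a ≤ 1 :=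
  Set.indicator_apply_le' (fun _ => le_rfl) fun _ => zero_le_one

theorem nodeErr_nonneg (t : ℕ) (i : Fin N) (a : ℝ) : 0 ≤ nodeErr c Tcal y m s t i a :=
  Set.indicator_nonneg (fun _ _ => zero_le_one) _

/-- At a negative level the prediction region is the whole space. -/
theorem clusterErr_eq_zero {k : Fin K} {a : ℝ} (hk : (calSet c Tcal k).Nonempty) (ha : a < 0)
    (t : ℕ) : clusterErr c Tcal y m s t k a = 0 := by
  refine Set.indicator_of_notMem (Set.notMem_compl_iff.2 fun i hi => ?_) _
  have hi' : c i = k := (Finset.mem_filter.1 hi).2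
  subst hi'
  simp only [nodeInterval, Set.mem_ofPred_eq, cutoff_eq_top hk ha, le_top]

/-- A node is covered whenever its cluster is. -/
theorem nodeErr_le_clusterErr (t : ℕ) (i : Fin N) (a : ℝ) :
    nodeErr c Tcal y m s t i a ≤ clusterErr c Tcal y m s t (c i) a := by
  refine Set.indicator_apply_le' (fun h => ?_) fun _ => clusterErr_nonneg t (c i) a
  have hi : i ∈ cluster c (c i) := by simp [cluster]
  have hy : y t ∈ (clusterRegion c Tcal y m s t (c i) a)ᶜ := fun hy => h (hy i hi)
  exact (Set.indicator_of_mem hy fun _ => (1 : ℝ)).ge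

variable {α γ : ℝ} {a₁ : Fin K → ℝ}

/-- The adaptive levels never fall below `-γ`. -/
theorem neg_le_aciLevel {k : Fin K} (hk : (calSet c Tcal k).Nonempty) (hα : 0 ≤ α) (hγ : 0 ≤ γ)
    (ha : 0 ≤ a₁ k) (n : ℕ) : -γ ≤ aciLevel c Tcal t₀ y m s α γ a₁ k n := by
  induction n with
  | zero => rw [aciLevel]; linarith
  | succ n ih =>
    rw [aciLevel]
    -- A negative level moves up by `γα`; a nonnegative one falls by at most `γ(1 - α) ≤ γ`.
    rcases lt_or_ge (aciLevel c Tcal t₀ y m s α γ a₁ k n) 0 with h | h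
    · rw [clusterErr_eq_zero hk h]
      nlinarith
    · have := clusterErr_le_one (c := c) (Tcal := Tcal) (y := y) (m := m) (s := s) (t₀ + n) k
        (aciLevel c Tcal t₀ y m s α γ a₁ k n)
      nlinarith

/-- The update rule telescopes. -/
theorem mul_sum_clusterErr (k : Fin K) (T : ℕ) :
    γ * ∑ n ∈ Finset.range T,
        clusterErr c Tcal y m s (t₀ + n) k (aciLevel c Tcal t₀ y m s α γ a₁ k n) =
      γ * α * T + a₁ k - aciLevel c Tcal t₀ y m s α γ a₁ k T := by
  induction T with
  | zero => simp [aciLevel]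
  | succ T ih =>
    rw [Finset.sum_range_succ, mul_add, ih, aciLevel]
    push_cast
    ring

/-- Dividing the telescoped identity by `γT` and using `-γ` as lower bound for the final level
leaves a transient term of order `1/T`. -/
theorem avgClusterErr_le {k : Fin K} (hk : (calSet c Tcal k).Nonempty) (hα : 0 ≤ α) (hγ : 0 < γ)
    (ha : 0 ≤ a₁ k) {T : ℕ} (hT : 0 < T) :
    avgClusterErr c Tcal t₀ y m s α γ a₁ k T ≤ α + (a₁ k + γ) / γ / T := by
  have hT' : (0 : ℝ) < T := by exact_mod_cast hT
  have hsum := mul_sum_clusterErr (c := c) (Tcal := Tcal) (t₀ := t₀) (y := y) (m := m) (s := s)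
    (α := α) (γ := γ) (a₁ := a₁) k T
  have hlow := neg_le_aciLevel (t₀ := t₀) (y := y) (m := m) (s := s) hk hα hγ.le ha T
  rw [avgClusterErr, one_div_mul_eq_div, div_le_iff₀ hT', add_mul, div_mul_cancel₀ _ hT'.ne',
    ← mul_le_mul_iff_right₀ hγ, hsum, mul_add, mul_div_cancel₀ _ hγ.ne']
  linarith

theorem avgNodeErr_le_avgClusterErr (i : Fin N) (T : ℕ) :
    avgNodeErr c Tcal t₀ y m s α γ a₁ i T ≤ avgClusterErr c Tcal t₀ y m s α γ a₁ (c i) T :=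
  mul_le_mul_of_nonneg_left (Finset.sum_le_sum fun _ _ => nodeErr_le_clusterErr _ _ _)
    (by positivity)

theorem avgClusterErr_nonneg (k : Fin K) (T : ℕ) :
    0 ≤ avgClusterErr c Tcal t₀ y m s α γ a₁ k T :=
  mul_nonneg (by positivity) (Finset.sum_nonneg fun _ _ => clusterErr_nonneg _ _ _)

theorem avgNodeErr_nonneg (i : Fin N) (T : ℕ) :
    0 ≤ avgNodeErr c Tcal t₀ y m s α γ a₁ i T :=
  mul_nonneg (by positivity) (Finset.sum_nonneg fun _ _ => nodeErr_nonneg _ _ _)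

theorem limsup_le_of_le_add_div {u : ℕ → ℝ} {a b : ℝ} (h0 : ∀ T, 0 ≤ u T)
    (h : ∀ T : ℕ, 0 < T → u T ≤ a + b / T) : limsup u atTop ≤ a := by
  have hlim : Tendsto (fun T : ℕ => a + b / (T : ℝ)) atTop (nhds a) := by
    simpa using (tendsto_const_div_atTop_nhds_zero_nat b).const_add a
  rw [← hlim.limsup_eq]
  exact limsup_le_limsup ((eventually_gt_atTop 0).mono h)
    -- A real `limsup` is a conditional infimum, so monotonicity needs `u` bounded below; this is
    -- the role of `h0`.
    (isBoundedUnder_of ⟨0, h0⟩ : IsBoundedUnder (· ≥ ·) atTop u).isCoboundedUnder_le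
    hlim.isBoundedUnder_le

/-- Along every path, the long-run miscoverage of a cluster is at most `α`. -/
theorem limsup_avgClusterErr_le {k : Fin K} (hk : (calSet c Tcal k).Nonempty) (hα : 0 ≤ α)
    (hγ : 0 < γ) (ha : 0 ≤ a₁ k) :
    limsup (avgClusterErr c Tcal t₀ y m s α γ a₁ k) atTop ≤ α :=
  limsup_le_of_le_add_div (avgClusterErr_nonneg k) fun _ hT => avgClusterErr_le hk hα hγ ha hT

/-- Along every path, the long-run miscoverage of a node is at most `α`. -/
theorem limsup_avgNodeErr_le {i : Fin N} (hk : (calSet c Tcal (c i)).Nonempty) (hα : 0 ≤ α)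
    (hγ : 0 < γ) (ha : 0 ≤ a₁ (c i)) :
    limsup (avgNodeErr c Tcal t₀ y m s α γ a₁ i) atTop ≤ α :=
  limsup_le_of_le_add_div (avgNodeErr_nonneg i) fun T hT =>
    (avgNodeErr_le_avgClusterErr i T).trans (avgClusterErr_le hk hα hγ ha hT)

end CoverageMixing

theorem theorem1 :
    ∃ c₁ c₂ : ℝ, 0 ≤ c₁ ∧ 0 ≤ c₂ ∧
      ∀ {Ω E : Type*} [MeasurableSpace Ω] [MeasurableSpace E] (P : Measure Ω)
        [IsProbabilityMeasure P] (N K : ℕ) (c : Fin N → Fin K)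
        (X : ℕ → Ω → E) (Y : ℕ → Ω → Fin N → ℝ) (muHat sigmaHat : ℕ → Ω → Fin N → ℝ)
        (C ρ α γ : ℝ) (nMin τgap t₀ : ℕ) (Tcal : Finset ℕ) (a₁ : Fin K → ℝ),
        (∀ t, Measurable (X t)) → (∀ t, Measurable (Y t)) →
        (∀ t, Measurable[CoverageMixing.forecastInfo X Y t] (muHat t)) →
        (∀ t, Measurable[CoverageMixing.forecastInfo X Y t] (sigmaHat t)) →
        (∀ t ω i, 0 < sigmaHat t ω i) →
        0 < C → 0 < ρ → ρ < 1 →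
        (∀ τ : ℕ, 1 ≤ τ →
          CoverageMixing.betaMixing P (fun t ω => (X t ω, Y t ω)) τ ≤ ENNReal.ofReal (C * ρ ^ τ)) →
        1 ≤ nMin → (∀ k, nMin ≤ (CoverageMixing.calSet c Tcal k).card) →
        (∀ t ∈ Tcal, t < t₀ ∧ t + τgap ≤ t₀) →
        0 < α → α < 1 → 0 < γ → γ < 1 → (∀ k, 0 ≤ a₁ k ∧ a₁ k ≤ 1) →
        ∀ᵐ ω ∂P,
          (∀ k : Fin K,
            limsup (CoverageMixing.avgClusterErr c Tcal t₀ (fun t => Y t ω) (fun t => muHat t ω)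
                (fun t => sigmaHat t ω) α γ a₁ k) atTop
              ≤ α + c₁ * (C * ρ ^ τgap / (1 - ρ)) + c₂ * γ) ∧
          (∀ i : Fin N,
            limsup (CoverageMixing.avgNodeErr c Tcal t₀ (fun t => Y t ω) (fun t => muHat t ω)
                (fun t => sigmaHat t ω) α γ a₁ i) atTop
              ≤ α + c₁ * (C * ρ ^ τgap / (1 - ρ)) + c₂ * γ) := by
  -- The pathwise limit bound is `α` itself, so both constants can be zero.
  refine ⟨0, 0, le_rfl, le_rfl, ?_⟩
  intro Ω E _ _ P _ N K c X Y muHat sigmaHat C ρ α γ nMin τgap t₀ Tcal a₁ _ _ _ _ _ _ _ _ _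
    hn hcard _ hα _ hγ _ ha
  have hne : ∀ k, (CoverageMixing.calSet c Tcal k).Nonempty := fun k =>
    Finset.card_pos.1 (hn.trans (hcard k))
  refine Eventually.of_forall fun ω => ?_
  simp only [zero_mul, add_zero]
  exact ⟨fun k => CoverageMixing.limsup_avgClusterErr_le (hne k) hα.le hγ (ha k).1,
    fun i => CoverageMixing.limsup_avgNodeErr_le (hne (c i)) hα.le hγ (ha (c i)).1⟩
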